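/- Let $F$ be a continuous (i.e. atomless) probability distribution with support in $[0,1]$ and let $n$ be a natural number. Two players observe independent samples $X_1,\dots,X_n$ of law $F$ arriving one at a time. At stage $t$, after $X_t$ has been observed, the players who are still present simultaneously either bid for one item in the current feasible set $\mathcal F_t$ or pass, possibly at random; their choice may depend, measurably, on the whole history (all samples so far, who bid for what and who got what at earlier stages). A player who bids alone for item $j$ gets it, receives the payoff $X_j$ and leaves the game; if both bid for the same item, each gets it with probability $1/2$, and the loser passes to the next stage. A player who never gets an item has payoff $0$, and players maximize their expected payoffs. * In the game with full recall, $\Gamma_n^{FR}$, $\mathcal F_t$ consists of all items in $\{1,\dots,t\}$ not yet selected, and at stage $n$ every player who is present selects the best available item; if both are present, a fair toss decides who gets it and the other gets the second best item (payoff $0$ if there is none). * In the game with no recall, $\Gamma_n^{NR}$, $\mathcal F_t=\{t\}$. A subgame perfect equilibrium (SPE) is a pair of strategies inducing a Nash equilibrium in the continuation game after every finite history $h_t$ of what happened up to stage $t$ (including the empty history). Let $E_n^{FR},E_n^{NR}\subset\mathbb R^2$ be the sets of SPE payoffs of $\Gamma_n^{FR}$ and $\Gamma_n^{NR}$. **Theorem.**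 If $(u,u)\in E_n^{FR}$ is any SPE payoff under full recall and $(v,v)\in E_n^{NR}$ is any symmetric SPE payoff under no recall, then $u\ge v$. -/

import Mathlib

open MeasureTheory
open scoped NNReal

noncomputable section

namespace CompetitiveSelection

/-- The two variants of the competitive selection problem. -/
inductive Variant
  | fullRecall
  | noRecall
  deriving DecidableEq

/-- What becomes public at a stage besides the sample: the item each of the two players tried to
get and the item each of them got (`none` stands for no item). Items are named by the stage,
counted from `0`, at which they arrive. -/
structure Record where
  bids : Fin 2 → Option ℕ
  got : Fin 2 → Option ℕ

/-- A player is still in the game after the records `r` if he got no item so far. -/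
def Present {t : ℕ} (r : Fin t → Record) (i : Fin 2) : Prop :=
  ∀ s, (r s).got i = none

instance {t : ℕ} (r : Fin t → Record) (i : Fin 2) : Decidable (Present r i) :=
  inferInstanceAs (Decidable (∀ s, (r s).got i = none))

/-- The feasible set at stage `t` (when the samples `0, …, t` have arrived) after the records `r`
of the stages before `t`: with full recall, all items that arrived and have not been selected;
with no recall, only the item that has just arrived. -/
def feasible (V : Variant) {t : ℕ} (r : Fin t → Record) : Finset ℕ :=
  match V with
  | .fullRecall => (Finset.range (t + 1)).filter fun j => ∀ s i, (r s).got i ≠ some j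
  | .noRecall => {t}

/-- The actions of player `i` at stage `t`: a feasible item, or `none` for passing. A player who
has left the game can only pass. -/
def actions (V : Variant) {t : ℕ} (r : Fin t → Record) (i : Fin 2) : Finset (Option ℕ) :=
  if Present r i then Finset.insertNone (feasible V r) else {none}

/-- A behaviour strategy of player `i`. At every stage `t`, the samples up to and including stage
`t` and the records of the earlier stages determine, measurably, a probability distribution over
the available actions. (Measurability is asked for every fixed sequence of records and every
action; these range over countable discrete sets.) -/
structure Strategy (V : Variant) (i : Fin 2) where
  act : (t : ℕ) → (Fin (t + 1) → unitInterval) → (Fin t → Record) → PMF (Option ℕ)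
  measurable_act : ∀ (t : ℕ) (r : Fin t → Record) (a : Option ℕ),
    Measurable fun x => act t x r a
  act_mem : ∀ (t : ℕ) (x : Fin (t + 1) → unitInterval) (r : Fin t → Record),
    ∀ a ∈ (act t x r).support, a ∈ actions V r i

/-- A pair of strategies. -/
abbrev Profile (V : Variant) := (i : Fin 2) → Strategy V i

/-- The items obtained when the players bid `b` and player `w` wins the toss: if both bid for the
same item only `w` gets it, otherwise everybody gets the item he bids for. -/
def allocate (b : Fin 2 → Option ℕ) (w : Fin 2) : Fin 2 → Option ℕ :=
  fun i => if b 0 = b 1 ∧ i ≠ w then none else b i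

/-- The sequences of records that can occur during the first `t` stages. Together with a sequence
of `t` samples they form a history up to stage `t`. -/
inductive IsHistory (V : Variant) : (t : ℕ) → (Fin t → Record) → Prop
  | nil (r : Fin 0 → Record) : IsHistory V 0 r
  | snoc {t : ℕ} {r : Fin t → Record} (b : Fin 2 → Option ℕ) (w : Fin 2)
      (hr : IsHistory V t r) (hb : ∀ i, b i ∈ actions V r i) :
      IsHistory V (t + 1) (Fin.snoc (α := fun _ => Record) r ⟨b, allocate b w⟩)

/-- The value of item `j`. -/
def value {m : ℕ} (x : Fin m → unitInterval) (j : ℕ) : ℝ≥0 :=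
  if h : j < m then unitInterval.toNNReal (x ⟨j, h⟩) else 0

/-- The value of the item that player `i` got according to the records; `0` if he got none. -/
def earned {m t : ℕ} (x : Fin m → unitInterval) (r : Fin t → Record) (i : Fin 2) : ℝ :=
  ∑ s, ((r s).got i).elim 0 fun j => (value x j : ℝ)

/-- The highest value among the items in `S`, and `0` if there are none. -/
def best {m : ℕ} (x : Fin m → unitInterval) (S : Finset ℕ) : ℝ≥0 :=
  S.sup (value x)

/-- The second highest value (counted with multiplicity) among the items in `S`, and `0` if there
are fewer than two. -/
def secondBest {m : ℕ} (x : Fin m → unitInterval) (S : Finset ℕ) : ℝ≥0 :=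
  S.offDiag.sup fun p => min (value x p.1) (value x p.2)

/-- The expected payoff of player `i` under full recall once the last sample has arrived. Everybody
who is present then selects the best available item; if both are present a fair toss decides who
gets it, and the other one gets the second best item. -/
def finalPayoff {t : ℕ} (x : Fin (t + 1) → unitInterval) (r : Fin t → Record) (i : Fin 2) : ℝ :=
  if Present r 0 ∧ Present r 1 then
    ((best x (feasible .fullRecall r) : ℝ) + (secondBest x (feasible .fullRecall r) : ℝ)) / 2
  else if Present r i then (best x (feasible .fullRecall r) : ℝ)
  else earned x r i

/-- The expectation of `g` of the record of stage `t`, over the independent choices of both players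
and the fair toss. -/
def stageMean {V : Variant} (σ : Profile V) {t : ℕ} (x : Fin (t + 1) → unitInterval) (r : Fin t → Record)
    (g : Record → ℝ) : ℝ :=
  ∑ a ∈ actions V r 0, ∑ b ∈ actions V r 1,
    ((σ 0).act t x r a).toReal * ((σ 1).act t x r b).toReal *
      ((g ⟨![a, b], allocate ![a, b] 0⟩ + g ⟨![a, b], allocate ![a, b] 1⟩) / 2)

/-- The expected payoff of player `i` under the profile `σ` in the continuation game with `k`
samples to arrive, independently with law `F`, after the history `(x, r)`. In the variant with full
recall there is no choice to make at the last stage. -/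
def payoff (V : Variant) (F : Measure unitInterval) (σ : Profile V) (i : Fin 2) :
    (k : ℕ) → {t : ℕ} → (Fin t → unitInterval) → (Fin t → Record) → ℝ
  | 0, _, x, r => earned x r i
  | k + 1, _, x, r =>
    if V = .fullRecall ∧ k = 0 then
      ∫ y, finalPayoff (Fin.snoc (α := fun _ => unitInterval) x y) r i ∂F
    else
      ∫ y, stageMean σ (Fin.snoc (α := fun _ => unitInterval) x y) r (fun ρ =>
        payoff V F σ i k (Fin.snoc (α := fun _ => unitInterval) x y)
          (Fin.snoc (α := fun _ => Record) r ρ)) ∂F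

/-- `σ` induces a Nash equilibrium in the continuation game with `k` samples to arrive after the
history `(x, r)`. -/
def IsNashAfter (V : Variant) (F : Measure unitInterval) (σ : Profile V) (k : ℕ) {t : ℕ}
    (x : Fin t → unitInterval) (r : Fin t → Record) : Prop :=
  ∀ (i : Fin 2) (τ : Strategy V i),
    payoff V F (Function.update σ i τ) i k x r ≤ payoff V F σ i k x r

/-- `σ` is a subgame perfect equilibrium of the game with `n` samples: it induces a Nash
equilibrium in the continuation game after every history, the empty one included. -/
def IsSPE (V : Variant) (F : Measure unitInterval) (n : ℕ) (σ : Profile V) : Prop :=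
  ∀ (t k : ℕ), t + k = n → ∀ (x : Fin t → unitInterval) (r : Fin t → Record), IsHistory V t r →
    IsNashAfter V F σ k x r

/-- The set of subgame perfect equilibrium payoffs of the game with `n` samples of law `F`. -/
def SPEPayoffs (V : Variant) (F : Measure unitInterval) (n : ℕ) : Set (ℝ × ℝ) :=
  {p | ∃ σ : Profile V, IsSPE V F n σ ∧
    p = (payoff V F σ 0 n Fin.elim0 Fin.elim0, payoff V F σ 1 n Fin.elim0 Fin.elim0)}

end CompetitiveSelection

end

/-! Both games are compared with a single number, `pairValue F n`: the optimal expected total of one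
decision maker who picks two of the `n` samples without recall.

Without recall, two players together cannot beat this decision maker, since at most one of them
takes an item per stage (`payoff_add_payoff_noRecall_le_pairValue`). A symmetric payoff `(v, v)`
therefore satisfies `2 * v ≤ pairValue F n`.

With full recall, player 0 can secure `pairValue F n / 2` against every opponent. Let `α` be the
best value so far, and let `m` be the expected maximum of the second best value and all samples
still to come. If the opponent takes any item, waiting until the end yields at least `m`. The
strategy bids for the best item when `α ≥ m` and passes otherwise. A bid yields `α` if uncontested
and at least `(α + m) / 2` on average in a tie; a pass yields at least `m > α` if the opponent takes
something. If nobody takes anything, induction applies. The invariant is the lower bound `max ((α +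
m) / 2) (pairValue / 2)` (`max_le_payoff_of_threshold`), and `max_le_integral` carries it across the
arrival of a sample. In equilibrium deviating to this strategy does not pay, so `u ≥ pairValue F n /
2 ≥ v`. -/

noncomputable section

namespace CompetitiveSelection

variable {V : Variant} {F : Measure unitInterval}

/-! ### Values of single- and two-item selection problems -/

/-- The optimal expected value of selecting one of `k` samples without recall. -/
def stopValue (F : Measure unitInterval) : ℕ → ℝ
  | 0 => 0
  | k + 1 => ∫ y, max (y : ℝ) (stopValue F k) ∂F

/-- The optimal expected total value of selecting two of `k` samples without recall. -/
def pairValue (F : Measure unitInterval) : ℕ → ℝ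
  | 0 => 0
  | k + 1 => ∫ y, max ((y : ℝ) + stopValue F k) (pairValue F k) ∂F

/-- The expected maximum of `b` and `k` samples. -/
def recallValue (F : Measure unitInterval) : ℕ → ℝ → ℝ
  | 0, b => b
  | k + 1, b => ∫ y, recallValue F k (max b (y : ℝ)) ∂F

lemma integrable_of_continuous [IsFiniteMeasure F] {f : unitInterval → ℝ} (hf : Continuous f) :
    Integrable f F :=
  hf.integrable_of_hasCompactSupport (HasCompactSupport.of_compactSpace f)

/-- Taking the maximum with `y` and averaging over `y` both preserve the two properties. The
Lipschitz bound serves twice: it gives continuity, and it is the estimate needed in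
`add_recallValue_le` when a new sample overtakes the best one. -/
lemma recallValue_lipschitz_monotone [IsProbabilityMeasure F] (k : ℕ) :
    LipschitzWith 1 (recallValue F k) ∧ Monotone (recallValue F k) := by
  induction k with
  | zero => exact ⟨LipschitzWith.id, monotone_id⟩
  | succ k ih =>
    obtain ⟨hl, hm⟩ := ih
    have hi : ∀ b : ℝ, Integrable (fun y : unitInterval => recallValue F k (max b (y : ℝ))) F :=
      fun b => integrable_of_continuous (hl.continuous.comp (by fun_prop))
    have hmono : Monotone (recallValue F (k + 1)) := fun a b hab =>
      integral_mono (hi a) (hi b) fun y => hm (max_le_max hab le_rfl)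
    refine ⟨LipschitzWith.of_le_add fun a b => ?_, hmono⟩
    calc recallValue F (k + 1) a
        ≤ ∫ y : unitInterval, (recallValue F k (max b (y : ℝ)) + dist a b) ∂F := by
          refine integral_mono (hi a) ((hi b).add (integrable_const _)) fun y => ?_
          have h1 := (LipschitzWith.le_add_mul hl (max a (y : ℝ)) (max b (y : ℝ)))
          have h2 : dist (max a (y : ℝ)) (max b (y : ℝ)) ≤ dist a b := by
            rw [Real.dist_eq, Real.dist_eq]
            exact abs_max_sub_max_le_abs _ _ _
          simp only [NNReal.coe_one, one_mul] at h1
          exact h1.trans (by gcongr)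
      _ = _ := by rw [integral_add (hi b) (integrable_const _)]; simp [recallValue]

lemma recallValue_mono [IsProbabilityMeasure F] (k : ℕ) : Monotone (recallValue F k) :=
  (recallValue_lipschitz_monotone k).2

lemma continuous_recallValue [IsProbabilityMeasure F] (k : ℕ) : Continuous (recallValue F k) :=
  (recallValue_lipschitz_monotone k).1.continuous

lemma integrable_recallValue [IsProbabilityMeasure F] (k : ℕ) (b : ℝ) :
    Integrable (fun y : unitInterval => recallValue F k (max b (y : ℝ))) F :=
  integrable_of_continuous ((continuous_recallValue k).comp (by fun_prop))

lemma recallValue_le_add_sub [IsProbabilityMeasure F] (k : ℕ) {a b : ℝ} (h : a ≤ b) :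
    recallValue F k b ≤ recallValue F k a + (b - a) := by
  have h1 := LipschitzWith.le_add_mul (recallValue_lipschitz_monotone (F := F) k).1 b a
  rwa [NNReal.coe_one, one_mul, Real.dist_eq, abs_of_nonneg (by linarith)] at h1

lemma le_recallValue [IsProbabilityMeasure F] (k : ℕ) (b : ℝ) : b ≤ recallValue F k b := by
  induction k generalizing b with
  | zero => exact le_rfl
  | succ k ih =>
    calc b = ∫ _ : unitInterval, b ∂F := by simp
      _ ≤ _ := integral_mono (integrable_const _) (integrable_recallValue k b)
        fun y => (le_max_left _ _).trans (ih _)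

/-- Hindsight dominates stopping: whatever item a stopping rule accepts is still counted in the
running maximum. -/
lemma stopValue_le_recallValue [IsProbabilityMeasure F] (k : ℕ) {b : ℝ} (hb : 0 ≤ b) :
    stopValue F k ≤ recallValue F k b := by
  induction k generalizing b with
  | zero => exact hb
  | succ k ih =>
    refine integral_mono (integrable_of_continuous (by fun_prop)) (integrable_recallValue k b)
      fun y => max_le ?_ (ih (hb.trans (le_max_left _ _)))
    exact (le_max_right _ _).trans (le_recallValue _ _)

/-- Each of the two selections, taken separately, is worth no more than the best single selection.
-/
lemma pairValue_le_two_mul_stopValue [IsProbabilityMeasure F] (k : ℕ) :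
    pairValue F k ≤ 2 * stopValue F k := by
  induction k with
  | zero => simp [pairValue, stopValue]
  | succ k ih =>
    rw [pairValue, stopValue, ← integral_const_mul]
    refine integral_mono (integrable_of_continuous (by fun_prop))
      (integrable_of_continuous (by fun_prop)) fun y => max_le ?_ ?_
    · linarith [le_max_left (y : ℝ) (stopValue F k), le_max_right (y : ℝ) (stopValue F k)]
    · linarith [le_max_right (y : ℝ) (stopValue F k)]

/-! ### Values of items -/

lemma value_snoc_of_lt {t : ℕ} (x : Fin t → unitInterval) (y : unitInterval) {j : ℕ} (h : j < t) :
    value (Fin.snoc (α := fun _ => unitInterval) x y) j = value x j := by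
  have : (⟨j, by omega⟩ : Fin (t + 1)) = Fin.castSucc ⟨j, h⟩ := rfl
  rw [value, value, dif_pos (show j < t + 1 by omega), dif_pos h, this, Fin.snoc_castSucc]

lemma value_snoc_self {t : ℕ} (x : Fin t → unitInterval) (y : unitInterval) :
    (value (Fin.snoc (α := fun _ => unitInterval) x y) t : ℝ) = y := by
  have : (⟨t, by omega⟩ : Fin (t + 1)) = Fin.last t := rfl
  rw [value, dif_pos (show t < t + 1 by omega), this, Fin.snoc_last]
  rfl

lemma value_of_le {t : ℕ} (x : Fin t → unitInterval) {j : ℕ} (h : t ≤ j) : value x j = 0 :=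
  dif_neg (by omega)

lemma value_le_snoc {t : ℕ} (x : Fin t → unitInterval) (y : unitInterval) (j : ℕ) :
    value x j ≤ value (Fin.snoc (α := fun _ => unitInterval) x y) j := by
  rcases lt_or_ge j t with h | h
  · rw [value_snoc_of_lt x y h]
  · simp [value_of_le x h]

lemma value_le_one {t : ℕ} (x : Fin t → unitInterval) (j : ℕ) : value x j ≤ 1 := by
  unfold value
  split_ifs with h
  · exact_mod_cast (x ⟨j, h⟩).2.2
  · exact zero_le_one

lemma measurable_value {t : ℕ} (j : ℕ) :
    Measurable fun x : Fin t → unitInterval => value x j := by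
  unfold value
  split_ifs with h
  · have : Continuous unitInterval.toNNReal := by fun_prop
    exact this.measurable.comp (measurable_pi_apply _)
  · exact measurable_const

lemma measurable_finset_sup {α β : Type*} [MeasurableSpace α] (S : Finset β) {f : α → β → ℝ≥0}
    (hf : ∀ b, Measurable fun a => f a b) : Measurable fun a => S.sup (f a) := by
  classical
  induction S using Finset.induction_on with
  | empty => simp
  | insert b S _ ih => simpa only [Finset.sup_insert] using (hf b).max ih

lemma measurable_best {t : ℕ} (S : Finset ℕ) :
    Measurable fun x : Fin t → unitInterval => best x S :=
  measurable_finset_sup S measurable_value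

lemma measurable_secondBest {t : ℕ} (S : Finset ℕ) :
    Measurable fun x : Fin t → unitInterval => secondBest x S :=
  measurable_finset_sup S.offDiag
    (f := fun x p => min (value x p.1) (value x p.2))
    fun p => (measurable_value p.1).min (measurable_value p.2)

lemma best_le_one {t : ℕ} (x : Fin t → unitInterval) (S : Finset ℕ) : best x S ≤ 1 :=
  Finset.sup_le fun j _ => value_le_one x j

lemma value_le_best {t : ℕ} (x : Fin t → unitInterval) {S : Finset ℕ} {j : ℕ} (h : j ∈ S) :
    value x j ≤ best x S :=
  Finset.le_sup (f := value x) h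

lemma min_le_secondBest {t : ℕ} (x : Fin t → unitInterval) {S : Finset ℕ} {i j : ℕ}
    (hi : i ∈ S) (hj : j ∈ S) (hij : i ≠ j) : min (value x i) (value x j) ≤ secondBest x S :=
  Finset.le_sup (f := fun p : ℕ × ℕ => min (value x p.1) (value x p.2))
    (Finset.mem_offDiag.2 ⟨hi, hj, hij⟩ : (i, j) ∈ S.offDiag)

lemma secondBest_le_best {t : ℕ} (x : Fin t → unitInterval) (S : Finset ℕ) :
    secondBest x S ≤ best x S :=
  Finset.sup_le fun _ hp => (min_le_left _ _).trans (value_le_best x (Finset.mem_offDiag.1 hp).1)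

/-- Of two distinct items at most one is `j`, and the other one is worth at least their minimum. -/
lemma secondBest_le_best_erase {t : ℕ} (x : Fin t → unitInterval) (S : Finset ℕ) (j : ℕ) :
    secondBest x S ≤ best x (S.erase j) := by
  refine Finset.sup_le fun p hp => ?_
  obtain ⟨h1, h2, h3⟩ := Finset.mem_offDiag.1 hp
  by_cases h : p.1 = j
  · exact (min_le_right _ _).trans
      (value_le_best x (Finset.mem_erase.2 ⟨fun h' => h3 (h.trans h'.symm), h2⟩))
  · exact (min_le_left _ _).trans (value_le_best x (Finset.mem_erase.2 ⟨h, h1⟩))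

lemma exists_value_eq_best {t : ℕ} (x : Fin t → unitInterval) {S : Finset ℕ} (hS : S.Nonempty) :
    ∃ j ∈ S, value x j = best x S := by
  obtain ⟨j, hj, h⟩ := Finset.exists_mem_eq_sup S hS (value x)
  exact ⟨j, hj, h.symm⟩

lemma best_le_snoc {t : ℕ} (x : Fin t → unitInterval) (y : unitInterval) {S S' : Finset ℕ}
    (hS : S ⊆ S') : best x S ≤ best (Fin.snoc (α := fun _ => unitInterval) x y) S' :=
  Finset.sup_le fun j hj => (value_le_snoc x y j).trans (value_le_best _ (hS hj))

lemma secondBest_le_snoc {t : ℕ} (x : Fin t → unitInterval) (y : unitInterval) {S S' : Finset ℕ}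
    (hS : S ⊆ S') :
    secondBest x S ≤ secondBest (Fin.snoc (α := fun _ => unitInterval) x y) S' := by
  refine Finset.sup_le fun p hp => ?_
  obtain ⟨h1, h2, h3⟩ := Finset.mem_offDiag.1 hp
  exact (min_le_min (value_le_snoc x y _) (value_le_snoc x y _)).trans
    (min_le_secondBest _ (hS h1) (hS h2) h3)

lemma le_best_snoc {t : ℕ} (x : Fin t → unitInterval) (y : unitInterval) {S : Finset ℕ}
    (hS : t ∈ S) : (y : ℝ) ≤ best (Fin.snoc (α := fun _ => unitInterval) x y) S := by
  rw [← value_snoc_self x y]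
  exact_mod_cast value_le_best _ hS

lemma min_best_le_secondBest_snoc {t : ℕ} (x : Fin t → unitInterval) (y : unitInterval) :
    min (best x (Finset.range t) : ℝ) y ≤
      secondBest (Fin.snoc (α := fun _ => unitInterval) x y) (Finset.range (t + 1)) := by
  -- Before the first sample there is no earlier item, and `best` is `0` by convention.
  rcases Nat.eq_zero_or_pos t with rfl | ht
  · simp [best]
  obtain ⟨j, hj, h⟩ := exists_value_eq_best x (Finset.nonempty_range_iff.2 ht.ne')
  rw [Finset.mem_range] at hj
  rw [← h, ← value_snoc_self x y, ← value_snoc_of_lt x y hj]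
  exact_mod_cast min_le_secondBest _ (Finset.mem_range.2 (by omega))
    (Finset.mem_range.2 (by omega)) hj.ne

/-! ### Means over one stage -/

lemma sum_act_toReal {i : Fin 2} (s : Strategy V i) {t : ℕ} (x : Fin (t + 1) → unitInterval)
    (r : Fin t → Record) : ∑ a ∈ actions V r i, (s.act t x r a).toReal = 1 := by
  rw [← ENNReal.toReal_sum fun a _ => PMF.apply_ne_top _ a, ← ENNReal.toReal_one]
  congr 1
  rw [← (s.act t x r).tsum_coe, tsum_eq_sum]
  intro a ha
  by_contra h
  exact ha (s.act_mem t x r a ((PMF.mem_support_iff _ _).2 h))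

/-- The comparison is asked only for bids in the supports, and only for the sum over the two toss
outcomes: in a tie the bound needed later holds on average over the toss, not for each outcome. -/
lemma stageMean_mono (σ : Profile V) {t : ℕ} (x : Fin (t + 1) → unitInterval) (r : Fin t → Record)
    {g g' : Record → ℝ}
    (h : ∀ a ∈ ((σ 0).act t x r).support, ∀ b ∈ ((σ 1).act t x r).support,
      g ⟨![a, b], allocate ![a, b] 0⟩ + g ⟨![a, b], allocate ![a, b] 1⟩ ≤
        g' ⟨![a, b], allocate ![a, b] 0⟩ + g' ⟨![a, b], allocate ![a, b] 1⟩) :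
    stageMean σ x r g ≤ stageMean σ x r g' := by
  refine Finset.sum_le_sum fun a _ => Finset.sum_le_sum fun b _ => ?_
  by_cases ha : (σ 0).act t x r a = 0
  · simp [ha]
  by_cases hb : (σ 1).act t x r b = 0
  · simp [hb]
  have := h a ((PMF.mem_support_iff _ _).2 ha) b ((PMF.mem_support_iff _ _).2 hb)
  gcongr

lemma stageMean_const (σ : Profile V) {t : ℕ} (x : Fin (t + 1) → unitInterval)
    (r : Fin t → Record) (c : ℝ) : stageMean σ x r (fun _ => c) = c := by
  have h : stageMean σ x r (fun _ => c) =
      (∑ a ∈ actions V r 0, ((σ 0).act t x r a).toReal) *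
        (∑ b ∈ actions V r 1, ((σ 1).act t x r b).toReal) * ((c + c) / 2) := by
    rw [Finset.sum_mul_sum, Finset.sum_mul]
    exact Finset.sum_congr rfl fun a _ => (Finset.sum_mul _ _ _).symm
  rw [h, sum_act_toReal, sum_act_toReal]
  ring

lemma stageMean_add (σ : Profile V) {t : ℕ} (x : Fin (t + 1) → unitInterval)
    (r : Fin t → Record) (g g' : Record → ℝ) :
    stageMean σ x r g + stageMean σ x r g' = stageMean σ x r (fun ρ => g ρ + g' ρ) := by
  simp only [stageMean, ← Finset.sum_add_distrib]
  exact Finset.sum_congr rfl fun a _ => Finset.sum_congr rfl fun b _ => by ring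

lemma stageMean_le (σ : Profile V) {t : ℕ} (x : Fin (t + 1) → unitInterval) (r : Fin t → Record)
    {g : Record → ℝ} {c : ℝ}
    (h : ∀ a ∈ ((σ 0).act t x r).support, ∀ b ∈ ((σ 1).act t x r).support, ∀ w,
      g ⟨![a, b], allocate ![a, b] w⟩ ≤ c) : stageMean σ x r g ≤ c := by
  rw [← stageMean_const σ x r c]
  exact stageMean_mono σ x r fun a ha b hb => add_le_add (h a ha b hb 0) (h a ha b hb 1)

lemma le_stageMean (σ : Profile V) {t : ℕ} (x : Fin (t + 1) → unitInterval) (r : Fin t → Record)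
    {g : Record → ℝ} {c : ℝ}
    (h : ∀ a ∈ ((σ 0).act t x r).support, ∀ b ∈ ((σ 1).act t x r).support,
      2 * c ≤ g ⟨![a, b], allocate ![a, b] 0⟩ + g ⟨![a, b], allocate ![a, b] 1⟩) :
    c ≤ stageMean σ x r g := by
  rw [← stageMean_const σ x r c]
  exact stageMean_mono σ x r fun a ha b hb => by linarith [h a ha b hb]

lemma stageMean_mem_Icc (σ : Profile V) {t : ℕ} (x : Fin (t + 1) → unitInterval)
    (r : Fin t → Record) {g : Record → ℝ} {c : ℝ} (h : ∀ ρ, g ρ ∈ Set.Icc 0 c) :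
    stageMean σ x r g ∈ Set.Icc 0 c :=
  ⟨le_stageMean σ x r fun _ _ _ _ => by simpa using add_nonneg (h _).1 (h _).1,
    stageMean_le σ x r fun _ _ _ _ _ => (h _).2⟩

/-! ### Integrability of payoffs -/

lemma measurable_snoc (t : ℕ) : Measurable fun p : (Fin t → unitInterval) × unitInterval =>
    Fin.snoc (α := fun _ => unitInterval) p.1 p.2 := by
  refine measurable_pi_iff.2 fun j => ?_
  induction j using Fin.lastCases with
  | last => simpa only [Fin.snoc_last] using measurable_snd
  | cast j =>
    simp only [Fin.snoc_castSucc]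
    exact (measurable_pi_apply j).comp measurable_fst

lemma measurable_snoc_right {t : ℕ} (x : Fin t → unitInterval) :
    Measurable fun y : unitInterval => Fin.snoc (α := fun _ => unitInterval) x y :=
  (measurable_snoc t).comp measurable_prodMk_left

lemma measurable_earned {m t : ℕ} (r : Fin t → Record) (i : Fin 2) :
    Measurable fun x : Fin m → unitInterval => earned x r i := by
  refine Finset.measurable_fun_sum _ fun s _ => ?_
  cases (r s).got i with
  | none => exact measurable_const
  | some j => exact (measurable_value j).coe_nnreal_real

lemma measurable_finalPayoff {t : ℕ} (r : Fin t → Record) (i : Fin 2) :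
    Measurable fun x : Fin (t + 1) → unitInterval => finalPayoff x r i := by
  have h1 := (measurable_best (t := t + 1) (feasible .fullRecall r)).coe_nnreal_real
  have h2 := (measurable_secondBest (t := t + 1) (feasible .fullRecall r)).coe_nnreal_real
  unfold finalPayoff
  split_ifs
  · exact (h1.add h2).div_const 2
  · exact h1
  · exact measurable_earned r i

lemma measurable_stageMean (σ : Profile V) {t : ℕ} (r : Fin t → Record)
    {g : (Fin (t + 1) → unitInterval) → Record → ℝ} (hg : ∀ ρ, Measurable fun x => g x ρ) :
    Measurable fun x => stageMean σ x r (g x) := by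
  refine Finset.measurable_fun_sum _ fun a _ => Finset.measurable_fun_sum _ fun b _ => ?_
  exact ((((σ 0).measurable_act t r a).ennreal_toReal).mul
    (((σ 1).measurable_act t r b).ennreal_toReal)).mul (((hg _).add (hg _)).div_const 2)

lemma measurable_payoff [IsProbabilityMeasure F] (σ : Profile V) (i : Fin 2) (k : ℕ) {t : ℕ}
    (r : Fin t → Record) :
    Measurable fun x : Fin t → unitInterval => payoff V F σ i k x r := by
  induction k generalizing t with
  | zero => exact measurable_earned r i
  | succ k ih =>
    unfold payoff
    split_ifs
    · exact (((measurable_finalPayoff r i).comp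
        (measurable_snoc t)).stronglyMeasurable.integral_prod_right').measurable
    · exact (((measurable_stageMean σ r fun ρ => ih (Fin.snoc (α := fun _ => Record) r ρ)).comp
        (measurable_snoc t)).stronglyMeasurable.integral_prod_right').measurable

lemma earned_mem_Icc {m t : ℕ} (x : Fin m → unitInterval) (r : Fin t → Record) (i : Fin 2) :
    earned x r i ∈ Set.Icc (0 : ℝ) t := by
  have h : ∀ s, ((r s).got i).elim 0 (fun j => (value x j : ℝ)) ∈ Set.Icc (0 : ℝ) 1 := by
    intro s
    cases (r s).got i with
    | none => simp
    | some j => exact ⟨NNReal.coe_nonneg _, by exact_mod_cast value_le_one x j⟩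
  refine ⟨Finset.sum_nonneg fun s _ => (h s).1, ?_⟩
  exact (Finset.sum_le_sum fun s (_ : s ∈ Finset.univ) => (h s).2).trans (by simp)

lemma finalPayoff_mem_Icc {t : ℕ} (x : Fin (t + 1) → unitInterval) (r : Fin t → Record)
    (i : Fin 2) : finalPayoff x r i ∈ Set.Icc (0 : ℝ) (t + 1) := by
  have h1 : (best x (feasible .fullRecall r) : ℝ) ≤ 1 := by exact_mod_cast best_le_one x _
  have h2 : (secondBest x (feasible .fullRecall r) : ℝ) ≤ best x (feasible .fullRecall r) := by
    exact_mod_cast secondBest_le_best x _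
  have h3 := earned_mem_Icc x r i
  have h4 : (0 : ℝ) ≤ t := t.cast_nonneg
  unfold finalPayoff
  split_ifs
  · exact ⟨by positivity, by linarith⟩
  · exact ⟨by positivity, by linarith⟩
  · exact ⟨h3.1, by linarith [h3.2]⟩

lemma integral_mem_Icc [IsProbabilityMeasure F] {f : unitInterval → ℝ} (hf : Measurable f) {c : ℝ}
    (h : ∀ y, f y ∈ Set.Icc 0 c) : ∫ y, f y ∂F ∈ Set.Icc 0 c := by
  refine ⟨integral_nonneg fun y => (h y).1, ?_⟩
  calc ∫ y, f y ∂F ≤ ∫ _, c ∂F := by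
        refine integral_mono (Integrable.of_bound hf.aestronglyMeasurable c ?_)
          (integrable_const _) fun y => (h y).2
        exact Filter.Eventually.of_forall fun y => by
          rw [Real.norm_of_nonneg (h y).1]; exact (h y).2
    _ = c := by simp

lemma payoff_mem_Icc [IsProbabilityMeasure F] (σ : Profile V) (i : Fin 2) (k : ℕ) {t : ℕ}
    (x : Fin t → unitInterval) (r : Fin t → Record) :
    payoff V F σ i k x r ∈ Set.Icc (0 : ℝ) (t + k) := by
  induction k generalizing t with
  | zero => simpa [payoff] using earned_mem_Icc x r i
  | succ k ih =>
    unfold payoff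
    split_ifs with h
    · obtain ⟨-, rfl⟩ := h
      simpa using integral_mem_Icc ((measurable_finalPayoff r i).comp (measurable_snoc_right x))
        fun y => finalPayoff_mem_Icc _ r i
    · have hm := measurable_stageMean σ r (g := fun x ρ => payoff V F σ i k x
        (Fin.snoc (α := fun _ => Record) r ρ)) fun ρ => measurable_payoff σ i k _
      have := hm.comp (measurable_snoc_right x)
      refine integral_mem_Icc this ?_
      intro y
      dsimp only [Function.comp]
      refine stageMean_mem_Icc σ _ r fun ρ => ?_
      convert ih (Fin.snoc (α := fun _ => unitInterval) x y) _ using 2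
      push_cast
      ring

lemma integrable_finalPayoff [IsProbabilityMeasure F] (i : Fin 2) {t : ℕ}
    (x : Fin t → unitInterval) (r : Fin t → Record) :
    Integrable (fun y => finalPayoff (Fin.snoc (α := fun _ => unitInterval) x y) r i) F := by
  refine Integrable.of_bound ((measurable_finalPayoff r i).comp
    (measurable_snoc_right x)).aestronglyMeasurable (t + 1) (Filter.Eventually.of_forall fun y => ?_)
  have h := finalPayoff_mem_Icc (Fin.snoc (α := fun _ => unitInterval) x y) r i
  rw [Real.norm_of_nonneg h.1]
  exact h.2

lemma integrable_stageMean_payoff [IsProbabilityMeasure F] (σ : Profile V) (i : Fin 2) (k : ℕ)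
    {t : ℕ} (x : Fin t → unitInterval) (r : Fin t → Record) :
    Integrable (fun y => stageMean σ (Fin.snoc (α := fun _ => unitInterval) x y) r (fun ρ =>
      payoff V F σ i k (Fin.snoc (α := fun _ => unitInterval) x y)
        (Fin.snoc (α := fun _ => Record) r ρ))) F := by
  have hm := measurable_stageMean σ r (g := fun x ρ => payoff V F σ i k x
    (Fin.snoc (α := fun _ => Record) r ρ)) fun ρ => measurable_payoff σ i k _
  refine Integrable.of_bound (hm.comp (measurable_snoc_right x)).aestronglyMeasurable (t + 1 + k)
    (Filter.Eventually.of_forall fun y => ?_)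
  have h := stageMean_mem_Icc σ (Fin.snoc (α := fun _ => unitInterval) x y) r fun ρ =>
    payoff_mem_Icc (F := F) σ i k (Fin.snoc (α := fun _ => unitInterval) x y)
      (Fin.snoc (α := fun _ => Record) r ρ)
  push_cast at h
  rw [Real.norm_of_nonneg h.1]
  exact h.2

lemma payoff_noRecall_succ (σ : Profile .noRecall) (i : Fin 2) (k : ℕ) {t : ℕ}
    (x : Fin t → unitInterval) (r : Fin t → Record) :
    payoff .noRecall F σ i (k + 1) x r =
      ∫ y, stageMean σ (Fin.snoc (α := fun _ => unitInterval) x y) r (fun ρ =>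
        payoff .noRecall F σ i k (Fin.snoc (α := fun _ => unitInterval) x y)
          (Fin.snoc (α := fun _ => Record) r ρ)) ∂F := by
  rw [payoff, if_neg (by simp)]

lemma payoff_fullRecall_one (σ : Profile .fullRecall) (i : Fin 2) {t : ℕ}
    (x : Fin t → unitInterval) (r : Fin t → Record) :
    payoff .fullRecall F σ i 1 x r =
      ∫ y, finalPayoff (Fin.snoc (α := fun _ => unitInterval) x y) r i ∂F := by
  rw [payoff, if_pos (by simp)]

lemma payoff_fullRecall_add_two (σ : Profile .fullRecall) (i : Fin 2) (k : ℕ) {t : ℕ}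
    (x : Fin t → unitInterval) (r : Fin t → Record) :
    payoff .fullRecall F σ i (k + 2) x r =
      ∫ y, stageMean σ (Fin.snoc (α := fun _ => unitInterval) x y) r (fun ρ =>
        payoff .fullRecall F σ i (k + 1) (Fin.snoc (α := fun _ => unitInterval) x y)
          (Fin.snoc (α := fun _ => Record) r ρ)) ∂F := by
  rw [payoff, if_neg (by simp)]

/-! ### Records -/

/-- Only items that have already arrived have been selected. -/
def Causal {t : ℕ} (r : Fin t → Record) : Prop :=
  ∀ s i, ∀ j ∈ (r s).got i, j < t

lemma present_snoc {t : ℕ} {r : Fin t → Record} {ρ : Record} {i : Fin 2} :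
    Present (Fin.snoc (α := fun _ => Record) r ρ : Fin (t + 1) → Record) i ↔
      Present r i ∧ ρ.got i = none := by
  simp only [Present, Fin.forall_fin_succ', Fin.snoc_castSucc, Fin.snoc_last]

lemma earned_snoc {m t : ℕ} (x : Fin m → unitInterval) (r : Fin t → Record) (ρ : Record)
    (i : Fin 2) :
    earned x (Fin.snoc (α := fun _ => Record) r ρ : Fin (t + 1) → Record) i =
      earned x r i + (ρ.got i).elim 0 fun j => (value x j : ℝ) := by
  simp only [earned, Fin.sum_univ_castSucc, Fin.snoc_castSucc, Fin.snoc_last]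

lemma earned_of_present {m t : ℕ} (x : Fin m → unitInterval) {r : Fin t → Record} {i : Fin 2}
    (h : Present r i) : earned x r i = 0 :=
  Finset.sum_eq_zero fun s _ => by rw [h s]; rfl

lemma Causal.earned_snoc_left {t : ℕ} {r : Fin t → Record} (hr : Causal r)
    (x : Fin t → unitInterval) (y : unitInterval) (i : Fin 2) :
    earned (Fin.snoc (α := fun _ => unitInterval) x y) r i = earned x r i := by
  refine Finset.sum_congr rfl fun s _ => ?_
  cases h : (r s).got i with
  | none => rfl
  | some j => simp only [Option.elim, value_snoc_of_lt x y (hr s i j h)]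

lemma feasible_subset {t : ℕ} (r : Fin t → Record) : feasible V r ⊆ Finset.range (t + 1) := by
  cases V with
  | fullRecall => exact Finset.filter_subset _ _
  | noRecall => simp [feasible]

lemma mem_feasible_of_mem_actions {t : ℕ} {r : Fin t → Record} {i : Fin 2} {j : ℕ}
    (h : some j ∈ actions V r i) : j ∈ feasible V r := by
  unfold actions at h
  split_ifs at h
  · simpa using h
  · simp at h

lemma eq_none_of_not_present {t : ℕ} {r : Fin t → Record} {i : Fin 2} {a : Option ℕ}
    (hi : ¬Present r i) (h : a ∈ actions V r i) : a = none := by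
  simpa [actions, hi] using h

lemma mem_of_mem_allocate {b : Fin 2 → Option ℕ} {w i : Fin 2} {j : ℕ}
    (h : j ∈ allocate b w i) : b i = some j := by
  unfold allocate at h
  split_ifs at h
  · simp at h
  · exact h

lemma allocate_of_none {b : Fin 2 → Option ℕ} {w i : Fin 2} (h : b i = none) :
    allocate b w i = none := by
  simp [allocate, h]

lemma Causal.snoc {t : ℕ} {r : Fin t → Record} (hr : Causal r) {b : Fin 2 → Option ℕ} (w : Fin 2)
    (hb : ∀ i, b i ∈ actions V r i) :
    Causal (Fin.snoc (α := fun _ => Record) r ⟨b, allocate b w⟩ : Fin (t + 1) → Record) := by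
  intro s i j h
  induction s using Fin.lastCases with
  | last =>
    rw [Fin.snoc_last] at h
    have h2 := hb i
    rw [mem_of_mem_allocate h] at h2
    exact Finset.mem_range.1 (feasible_subset r (mem_feasible_of_mem_actions h2))
  | cast s =>
    rw [Fin.snoc_castSucc] at h
    exact (hr s i j h).trans (Nat.lt_succ_self t)

lemma mem_actions_cons {σ : Profile V} {t : ℕ} {x : Fin (t + 1) → unitInterval}
    {r : Fin t → Record} {a b : Option ℕ} (ha : a ∈ ((σ 0).act t x r).support)
    (hb : b ∈ ((σ 1).act t x r).support) (i : Fin 2) : (![a, b] : Fin 2 → Option ℕ) i ∈ actions V r i := by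
  fin_cases i
  · exact (σ 0).act_mem t x r a ha
  · exact (σ 1).act_mem t x r b hb

/-- A player who has left can only pass, so his records add nothing more. `Causal` is needed because
an item that has not arrived has value `0` by default and would change value when its sample comes.
-/
lemma payoff_of_not_present [IsProbabilityMeasure F] (σ : Profile V) {i : Fin 2} (k : ℕ) {t : ℕ}
    (x : Fin t → unitInterval) {r : Fin t → Record} (hr : Causal r) (hi : ¬Present r i) :
    payoff V F σ i k x r = earned x r i := by
  induction k generalizing t with
  | zero => rfl
  | succ k ih =>
    unfold payoff
    split_ifs with h
    · have hf : ∀ y, finalPayoff (Fin.snoc (α := fun _ => unitInterval) x y) r i =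
          earned x r i := by
        intro y
        have : ¬(Present r 0 ∧ Present r 1) := by
          rintro ⟨h0, h1⟩
          fin_cases i
          · exact hi h0
          · exact hi h1
        rw [finalPayoff, if_neg this, if_neg hi, hr.earned_snoc_left]
      simp [hf]
    · have hf : ∀ y, ∀ a ∈ ((σ 0).act t (Fin.snoc (α := fun _ => unitInterval) x y) r).support,
          ∀ b ∈ ((σ 1).act t (Fin.snoc (α := fun _ => unitInterval) x y) r).support, ∀ w,
          payoff V F σ i k (Fin.snoc (α := fun _ => unitInterval) x y)
            (Fin.snoc (α := fun _ => Record) r ⟨![a, b], allocate ![a, b] w⟩) = earned x r i := by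
        intro y a ha b hb w
        have hn := eq_none_of_not_present hi (mem_actions_cons ha hb i)
        rw [ih _ (hr.snoc w (mem_actions_cons ha hb)) fun hp => hi (present_snoc.1 hp).1,
          earned_snoc, hr.earned_snoc_left]
        simp [allocate_of_none hn]
      have hs : ∀ y, stageMean σ (Fin.snoc (α := fun _ => unitInterval) x y) r (fun ρ =>
          payoff V F σ i k (Fin.snoc (α := fun _ => unitInterval) x y)
            (Fin.snoc (α := fun _ => Record) r ρ)) = earned x r i := fun y =>
        le_antisymm (stageMean_le σ _ r fun a ha b hb w => (hf y a ha b hb w).le)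
          (le_stageMean σ _ r fun a ha b hb => by
            rw [hf y a ha b hb, hf y a ha b hb, two_mul])
      simp [hs]

lemma payoff_of_got [IsProbabilityMeasure F] (σ : Profile V) {i : Fin 2} (k : ℕ) {t : ℕ}
    (x : Fin (t + 1) → unitInterval) {r : Fin t → Record} {ρ : Record}
    (hr : Causal (Fin.snoc (α := fun _ => Record) r ρ : Fin (t + 1) → Record)) (hi : Present r i)
    {j : ℕ} (hj : ρ.got i = some j) :
    payoff V F σ i k x (Fin.snoc (α := fun _ => Record) r ρ) = value x j := by
  rw [payoff_of_not_present σ k x hr fun hp => by simp [(present_snoc.1 hp).2] at hj,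
    earned_snoc, earned_of_present x hi, hj]
  simp

/-! ### No recall -/

lemma eq_of_mem_actions_noRecall {t : ℕ} {r : Fin t → Record} {i : Fin 2} {j : ℕ}
    (h : some j ∈ actions .noRecall r i) : j = t := by
  simpa [feasible] using mem_feasible_of_mem_actions h

lemma payoff_noRecall_le_stopValue [IsProbabilityMeasure F] (σ : Profile .noRecall) {i : Fin 2}
    (k : ℕ) {t : ℕ} (x : Fin t → unitInterval) {r : Fin t → Record} (hr : Causal r)
    (hi : Present r i) : payoff .noRecall F σ i k x r ≤ stopValue F k := by
  induction k generalizing t with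
  | zero => exact (earned_of_present x hi).le
  | succ k ih =>
    rw [payoff_noRecall_succ]
    refine integral_mono (integrable_stageMean_payoff σ i k x r)
      (integrable_of_continuous (by fun_prop)) fun y => ?_
    refine stageMean_le σ _ r fun a ha b hb w => ?_
    have hA := mem_actions_cons ha hb
    have hr' := hr.snoc w hA
    cases hg : allocate ![a, b] w i with
    | none => exact (ih _ hr' (present_snoc.2 ⟨hi, hg⟩)).trans (le_max_right _ _)
    | some j =>
      rw [payoff_of_got σ k _ hr' hi hg]
      have h2 := hA i
      rw [mem_of_mem_allocate hg] at h2
      rw [eq_of_mem_actions_noRecall h2, value_snoc_self]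
      exact le_max_left _ _

/-- Only one item is available per stage. Either nobody takes it and the pair problem continues, or
one player takes it and the other faces a single selection problem, bounded by
`payoff_noRecall_le_stopValue`. -/
lemma payoff_add_payoff_noRecall_le_pairValue [IsProbabilityMeasure F] (σ : Profile .noRecall)
    (k : ℕ) {t : ℕ} (x : Fin t → unitInterval) {r : Fin t → Record} (hr : Causal r)
    (h0 : Present r 0) (h1 : Present r 1) :
    payoff .noRecall F σ 0 k x r + payoff .noRecall F σ 1 k x r ≤ pairValue F k := by
  induction k generalizing t with
  | zero => exact (by rw [earned_of_present x h0, earned_of_present x h1, add_zero] :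
      earned x r 0 + earned x r 1 = 0).le
  | succ k ih =>
    rw [payoff_noRecall_succ, payoff_noRecall_succ,
      ← integral_add (integrable_stageMean_payoff σ 0 k x r) (integrable_stageMean_payoff σ 1 k x r)]
    refine integral_mono ((integrable_stageMean_payoff σ 0 k x r).add
      (integrable_stageMean_payoff σ 1 k x r)) (integrable_of_continuous (by fun_prop)) fun y => ?_
    dsimp only
    rw [stageMean_add]
    refine stageMean_le σ _ r fun a ha b hb w => ?_
    have hA := mem_actions_cons ha hb
    have hr' := hr.snoc w hA
    have hgot : ∀ i j, allocate ![a, b] w i = some j → (![a, b] : Fin 2 → Option ℕ) i = some t := by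
      intro i j hg
      have h2 := hA i
      rw [mem_of_mem_allocate hg] at h2
      rw [mem_of_mem_allocate hg, eq_of_mem_actions_noRecall h2]
    cases hg0 : allocate ![a, b] w 0 with
    | none =>
      cases hg1 : allocate ![a, b] w 1 with
      | none =>
        exact (ih _ hr' (present_snoc.2 ⟨h0, hg0⟩) (present_snoc.2 ⟨h1, hg1⟩)).trans
          (le_max_right _ _)
      | some j =>
        have hj := mem_of_mem_allocate hg1
        rw [hgot 1 j hg1, Option.some_inj] at hj
        rw [payoff_of_got σ k _ hr' h1 hg1, ← hj, value_snoc_self, add_comm]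
        exact (add_le_add le_rfl (payoff_noRecall_le_stopValue σ k _ hr'
          (present_snoc.2 ⟨h0, hg0⟩))).trans (le_max_left _ _)
    | some j =>
      have hj := mem_of_mem_allocate hg0
      rw [hgot 0 j hg0, Option.some_inj] at hj
      cases hg1 : allocate ![a, b] w 1 with
      | none =>
        rw [payoff_of_got σ k _ hr' h0 hg0, ← hj, value_snoc_self]
        exact (add_le_add le_rfl (payoff_noRecall_le_stopValue σ k _ hr'
          (present_snoc.2 ⟨h1, hg1⟩))).trans (le_max_left _ _)
      | some j' =>
        -- Both players would have obtained item `t`, but then their bids coincide and the loser of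
        -- the toss gets nothing.
        have ha' := hgot 0 j hg0
        have hb' := hgot 1 j' hg1
        rw [allocate] at hg0 hg1
        simp only [ha', hb'] at hg0 hg1
        fin_cases w <;> simp at hg0 hg1

/-! ### Full recall -/

open Classical in
/-- The item for which the threshold strategy bids at stage `t` of the game with `n` samples: the
best item, provided that it is worth at least what the loser of the toss for it can expect. -/
def thresholdBid (F : Measure unitInterval) (n t : ℕ) (x : Fin (t + 1) → unitInterval) :
    Option ℕ :=
  -- After the sample of stage `t`, which is number `t + 1`, there remain `n - (t + 1)` samples.
  if recallValue F (n - (t + 1)) (secondBest x (Finset.range (t + 1))) ≤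
      best x (Finset.range (t + 1)) then
    -- Among several best items the latest is chosen; any rule would do, and this one is measurable.
    some (Nat.findGreatest (fun j => value x j = best x (Finset.range (t + 1))) t)
  else none

open Classical in
lemma measurableSet_thresholdBid_eq [IsProbabilityMeasure F] (n t : ℕ) (a : Option ℕ) :
    MeasurableSet {x | thresholdBid F n t x = a} := by
  have h1 := measurable_best (t := t + 1) (Finset.range (t + 1))
  have h2 := measurable_secondBest (t := t + 1) (Finset.range (t + 1))
  have hc : MeasurableSet {x : Fin (t + 1) → unitInterval |
      recallValue F (n - (t + 1)) (secondBest x (Finset.range (t + 1))) ≤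
        best x (Finset.range (t + 1))} :=
    measurableSet_le ((continuous_recallValue _).measurable.comp h2.coe_nnreal_real)
      h1.coe_nnreal_real
  cases a with
  | none =>
    convert hc.compl using 1
    ext x
    simp [thresholdBid]
  | some j =>
    have hf : Measurable fun x : Fin (t + 1) → unitInterval =>
        Nat.findGreatest (fun j => value x j = best x (Finset.range (t + 1))) t :=
      measurable_findGreatest fun j _ => measurableSet_eq_fun (measurable_value j) h1
    convert hc.inter (hf (measurableSet_singleton j)) using 1
    ext x
    simp [thresholdBid]

open Classical in
lemma thresholdBid_spec {n t : ℕ} {x : Fin (t + 1) → unitInterval} {j : ℕ}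
    (h : thresholdBid F n t x = some j) :
    j ≤ t ∧ value x j = best x (Finset.range (t + 1)) ∧
      recallValue F (n - (t + 1)) (secondBest x (Finset.range (t + 1))) ≤
        best x (Finset.range (t + 1)) := by
  rw [thresholdBid] at h
  split_ifs at h with hc
  rw [Option.some_inj] at h
  obtain ⟨i, hi, hv⟩ := exists_value_eq_best x (S := Finset.range (t + 1)) (by simp)
  have hs := Nat.findGreatest_spec (P := fun j => value x j = best x (Finset.range (t + 1)))
    (Nat.lt_succ_iff.1 (Finset.mem_range.1 hi)) hv
  rw [h] at hs
  exact ⟨h ▸ Nat.findGreatest_le t, hs, hc⟩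

open Classical in
lemma lt_recallValue_of_thresholdBid_eq_none {n t : ℕ} {x : Fin (t + 1) → unitInterval}
    (h : thresholdBid F n t x = none) :
    (best x (Finset.range (t + 1)) : ℝ) <
      recallValue F (n - (t + 1)) (secondBest x (Finset.range (t + 1))) := by
  rw [thresholdBid] at h
  split_ifs at h with hc
  exact not_le.1 hc

lemma feasible_of_present {t : ℕ} {r : Fin t → Record} (h0 : Present r 0) (h1 : Present r 1) :
    feasible .fullRecall r = Finset.range (t + 1) := by
  refine Finset.filter_true_of_mem fun j _ s i => ?_
  fin_cases i
  · simp [h0 s]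
  · simp [h1 s]

/-- The strategy that follows `thresholdBid` while both players are present and waits for the end
afterwards. -/
def thresholdStrategy (F : Measure unitInterval) [IsProbabilityMeasure F] (n : ℕ) :
    Strategy .fullRecall 0 where
  act t x r := PMF.pure (if Present r 0 ∧ Present r 1 then thresholdBid F n t x else none)
  measurable_act t r a := by
    classical
    simp only [PMF.pure_apply]
    refine Measurable.ite ?_ measurable_const measurable_const
    split_ifs
    · simpa only [eq_comm] using measurableSet_thresholdBid_eq n t a
    · exact MeasurableSet.const _
  act_mem t x r a ha := by
    rw [PMF.support_pure, Set.mem_singleton_iff] at ha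
    subst ha
    split_ifs with h
    · rw [actions, if_pos h.1, feasible_of_present h.1 h.2]
      cases hb : thresholdBid F n t x with
      | none => simp
      | some j => simpa using Nat.lt_succ_of_le (thresholdBid_spec hb).1
    · unfold actions
      split_ifs <;> simp

/-- Waiting for another sample does not decrease the best value plus what is left. -/
lemma add_recallValue_le [IsProbabilityMeasure F] (k : ℕ) {a b a' b' : ℝ} (y : ℝ) (hab : b ≤ a)
    (ha : a ≤ a') (hy : y ≤ a') (hb : b ≤ b') (hm : min a y ≤ b') :
    a + recallValue F k (max b y) ≤ a' + recallValue F k b' := by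
  rcases le_total y a with h | h
  · rw [min_eq_right h] at hm
    exact add_le_add ha (recallValue_mono k (max_le hb hm))
  · rw [min_eq_left h] at hm
    -- The new sample overtakes `a`, which becomes a runner-up. Replacing `y` by `a` inside
    -- `recallValue` costs at most `y - a`, and the rise of the best value from `a` to `a' ≥ y` pays
    -- for it.
    rw [max_eq_right (hab.trans h)]
    linarith [recallValue_le_add_sub (F := F) k h, recallValue_mono (F := F) k hm]

/-- Averaging over the next sample turns the invariant after its arrival into the invariant before
it. This half of the induction does not involve strategies and serves the last stage as well as the
earlier ones. -/
lemma max_le_integral [IsProbabilityMeasure F] (k : ℕ) {t : ℕ} (x : Fin t → unitInterval)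
    {f : unitInterval → ℝ} (hf : Integrable f F)
    (h : ∀ y, max ((best (Fin.snoc (α := fun _ => unitInterval) x y) (Finset.range (t + 1)) +
      recallValue F k (secondBest (Fin.snoc (α := fun _ => unitInterval) x y)
        (Finset.range (t + 1)))) / 2) (pairValue F k / 2) ≤ f y) :
    max ((best x (Finset.range t) + recallValue F (k + 1) (secondBest x (Finset.range t))) / 2)
      (pairValue F (k + 1) / 2) ≤ ∫ y, f y ∂F := by
  have hi := integrable_recallValue (F := F) k (secondBest x (Finset.range t))
  have hsub : Finset.range t ⊆ Finset.range (t + 1) := Finset.range_mono (Nat.le_succ t)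
  refine max_le ?_ ?_
  · calc _ = ∫ y : unitInterval, ((best x (Finset.range t) : ℝ) +
          recallValue F k (max (secondBest x (Finset.range t) : ℝ) y)) / 2 ∂F := by
          rw [integral_div, integral_add (integrable_const _) hi]
          simp [recallValue]
      _ ≤ _ := by
          refine integral_mono (((integrable_const _).add hi).div_const 2) hf fun y => ?_
          refine le_trans ?_ ((le_max_left _ _).trans (h y))
          refine div_le_div_of_nonneg_right (add_recallValue_le k (y : ℝ) ?_ ?_ ?_ ?_ ?_)
            zero_le_two
          · exact_mod_cast secondBest_le_best x _
          · exact_mod_cast best_le_snoc x y hsub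
          · exact le_best_snoc x y (Finset.self_mem_range_succ t)
          · exact_mod_cast secondBest_le_snoc x y hsub
          · exact min_best_le_secondBest_snoc x y
  -- If the pair problem accepts `y`, its value `y + stopValue F k` is at most the best value plus
  -- the recall value of the second best.
  · rw [pairValue, ← integral_div]
    refine integral_mono ((integrable_of_continuous (by fun_prop)).div_const 2) hf fun y => ?_
    refine le_trans ?_ (h y)
    rw [max_div_div_right zero_le_two]
    refine div_le_div_of_nonneg_right (max_le_max (add_le_add ?_ ?_) le_rfl) zero_le_two
    · exact le_best_snoc x y (Finset.self_mem_range_succ t)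
    · exact stopValue_le_recallValue k (NNReal.coe_nonneg _)

/-! ### What the threshold strategy secures against an arbitrary opponent. -/

section Guarantee

variable [IsProbabilityMeasure F] {n : ℕ} {σ : Profile .fullRecall}

lemma eq_of_mem_support_thresholdStrategy (hσ : σ 0 = thresholdStrategy F n) {t : ℕ}
    {x : Fin (t + 1) → unitInterval} {r : Fin t → Record} {a : Option ℕ}
    (ha : a ∈ ((σ 0).act t x r).support) :
    a = if Present r 0 ∧ Present r 1 then thresholdBid F n t x else none := by
  rw [hσ] at ha
  simpa [thresholdStrategy, PMF.support_pure] using ha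

/-- The items left at stage `t + 1` comprise those left at stage `t`, if nobody gets an item. -/
lemma feasible_subset_snoc {t : ℕ} {r : Fin t → Record} {ρ : Record} (h : ∀ i, ρ.got i = none) :
    feasible .fullRecall r ⊆
      feasible .fullRecall (Fin.snoc (α := fun _ => Record) r ρ : Fin (t + 1) → Record) := by
  intro j hj
  simp only [feasible, Finset.mem_filter, Finset.mem_range, Fin.forall_fin_succ',
    Fin.snoc_castSucc, Fin.snoc_last, h] at hj ⊢
  exact ⟨by omega, hj.2, by simp⟩

lemma Causal.self_mem_feasible {t : ℕ} {r : Fin t → Record} (hr : Causal r) :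
    t ∈ feasible .fullRecall r :=
  Finset.mem_filter.2 ⟨Finset.self_mem_range_succ t, fun s i h => (hr s i t h).false⟩

/-- Once the opponent has left, nothing is lost by waiting: every item left and every later sample
is still there at the end. The feasible set already contains item `t`, whose sample is not part of
`x`; it counts as `0` in `best x`. -/
lemma recallValue_le_payoff_of_alone (hσ : σ 0 = thresholdStrategy F n) (k : ℕ) {t : ℕ}
    (x : Fin t → unitInterval) {r : Fin t → Record} (hr : Causal r) (h0 : Present r 0)
    (h1 : ¬Present r 1) :
    recallValue F (k + 1) (best x (feasible .fullRecall r)) ≤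
      payoff .fullRecall F σ 0 (k + 1) x r := by
  have hmax : ∀ y : unitInterval, max (best x (feasible .fullRecall r) : ℝ) y ≤
      best (Fin.snoc (α := fun _ => unitInterval) x y) (feasible .fullRecall r) := fun y =>
    max_le (by exact_mod_cast best_le_snoc x y subset_rfl) (le_best_snoc x y hr.self_mem_feasible)
  induction k generalizing t with
  | zero =>
    rw [payoff_fullRecall_one]
    refine integral_mono (integrable_recallValue 0 _) (integrable_finalPayoff 0 x r) fun y => ?_
    rw [finalPayoff, if_neg fun h => h1 h.2, if_pos h0]
    exact hmax y
  | succ k ih =>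
    rw [payoff_fullRecall_add_two]
    refine integral_mono (integrable_recallValue (k + 1) _)
      (integrable_stageMean_payoff σ 0 (k + 1) x r) fun y => ?_
    refine le_stageMean σ _ r fun a ha b hb => ?_
    have hA := mem_actions_cons ha hb
    have ha' := eq_of_mem_support_thresholdStrategy hσ ha
    rw [if_neg fun h => h1 h.2] at ha'
    have hb' : b = none := eq_none_of_not_present h1 (hA 1)
    subst ha' hb'
    have hn : ∀ w i, allocate ![none, none] w i = none := fun w i =>
      allocate_of_none (by fin_cases i <;> rfl)
    have key : ∀ w, recallValue F (k + 1) (max (best x (feasible .fullRecall r) : ℝ) y) ≤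
        payoff .fullRecall F σ 0 (k + 1) (Fin.snoc (α := fun _ => unitInterval) x y)
          (Fin.snoc (α := fun _ => Record) r ⟨![none, none], allocate ![none, none] w⟩) := by
      intro w
      refine (recallValue_mono _ ((hmax y).trans ?_)).trans
        (ih _ (hr.snoc w hA) (present_snoc.2 ⟨h0, hn w 0⟩) (fun hp => h1 (present_snoc.1 hp).1) ?_)
      · exact_mod_cast Finset.sup_mono (feasible_subset_snoc (hn w))
      · exact fun y' => max_le (by exact_mod_cast best_le_snoc _ y' subset_rfl)
          (le_best_snoc _ y' (hr.snoc w hA).self_mem_feasible)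
    linarith [key 0, key 1]

/-- Losing at most one item to the other player leaves the second best item. -/
lemma secondBest_le_best_feasible {t : ℕ} (x : Fin (t + 1) → unitInterval) {r : Fin t → Record}
    (h0 : Present r 0) (h1 : Present r 1) {ρ : Record} (hρ : ρ.got 0 = none) {j : ℕ}
    (hj : ρ.got 1 = some j) :
    secondBest x (Finset.range (t + 1)) ≤
      best x (feasible .fullRecall (Fin.snoc (α := fun _ => Record) r ρ : Fin (t + 1) → Record)) := by
  refine (secondBest_le_best_erase x _ j).trans (Finset.sup_mono fun i hi => ?_)
  obtain ⟨hij, hi⟩ := Finset.mem_erase.1 hi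
  rw [Finset.mem_range] at hi
  simp only [feasible, Finset.mem_filter, Finset.mem_range, Fin.forall_fin_succ',
    Fin.snoc_castSucc, Fin.snoc_last]
  exact ⟨by omega, fun s => by simp [h0 s, h1 s], by simp [hρ], by simpa [hj] using hij.symm⟩

/-- The two terms of the maximum play different roles: `(α + m) / 2` is what the bidding rule yields
as soon as someone takes an item, and `pairValue / 2` is the target, kept alive while both pass. -/
lemma max_le_payoff_of_threshold (hσ : σ 0 = thresholdStrategy F n) (k : ℕ) {t : ℕ}
    (ht : t + (k + 1) = n) (x : Fin t → unitInterval) {r : Fin t → Record} (hr : Causal r)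
    (h0 : Present r 0) (h1 : Present r 1) :
    max ((best x (Finset.range t) + recallValue F (k + 1) (secondBest x (Finset.range t))) / 2)
      (pairValue F (k + 1) / 2) ≤ payoff .fullRecall F σ 0 (k + 1) x r := by
  induction k generalizing t with
  | zero =>
    rw [payoff_fullRecall_one]
    refine max_le_integral _ x (integrable_finalPayoff 0 x r) fun y => ?_
    rw [finalPayoff, if_pos ⟨h0, h1⟩, feasible_of_present h0 h1]
    -- With no sample to come, `recallValue` is the identity and `pairValue` is `0`, so the first
    -- term is exactly the final payoff.
    exact max_le le_rfl (by simp only [pairValue, zero_div]; positivity)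
  | succ k ih =>
    rw [payoff_fullRecall_add_two]
    refine max_le_integral _ x (integrable_stageMean_payoff σ 0 (k + 1) x r) fun y => ?_
    set z : Fin (t + 1) → unitInterval := Fin.snoc (α := fun _ => unitInterval) x y
    set α : ℝ := NNReal.toReal (best z (Finset.range (t + 1))) with hα
    set m : ℝ := recallValue F (k + 1) (secondBest z (Finset.range (t + 1))) with hm
    -- Hence a payoff of at least `m` meets the target, and so does `(α + m) / 2` when `m ≤ α`.
    have hpm : pairValue F (k + 1) ≤ 2 * m := by
      have h2 := stopValue_le_recallValue (F := F) (k + 1)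
        (NNReal.coe_nonneg (secondBest z (Finset.range (t + 1))))
      linarith [pairValue_le_two_mul_stopValue (F := F) (k + 1)]
    have hnt : n - (t + 1) = k + 1 := by omega
    refine le_stageMean σ z r fun a ha b hb => ?_
    have hA := mem_actions_cons ha hb
    have ha' := eq_of_mem_support_thresholdStrategy hσ ha
    rw [if_pos ⟨h0, h1⟩] at ha'
    -- Whichever item the opponent takes, one worth at least the second best value survives.
    have hlose : ∀ w j, allocate ![a, b] w 0 = none → allocate ![a, b] w 1 = some j →
        m ≤ payoff .fullRecall F σ 0 (k + 1) z
          (Fin.snoc (α := fun _ => Record) r ⟨![a, b], allocate ![a, b] w⟩) := by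
      intro w j hw0 hw1
      refine (recallValue_mono _ ?_).trans (recallValue_le_payoff_of_alone hσ k z (hr.snoc w hA)
        (present_snoc.2 ⟨h0, hw0⟩) fun hp => by simpa [hw1] using (present_snoc.1 hp).2)
      exact_mod_cast secondBest_le_best_feasible z h0 h1 hw0 hw1
    cases a with
    | none =>
      have hlt := lt_recallValue_of_thresholdBid_eq_none ha'.symm
      rw [hnt, ← hα, ← hm] at hlt
      have hw0 : ∀ w, allocate ![none, b] w 0 = none := fun w => allocate_of_none rfl
      have key : ∀ w, max ((α + m) / 2) (pairValue F (k + 1) / 2) ≤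
          payoff .fullRecall F σ 0 (k + 1) z
            (Fin.snoc (α := fun _ => Record) r ⟨![none, b], allocate ![none, b] w⟩) := by
        intro w
        cases hw1 : allocate ![none, b] w 1 with
        | none =>
          have := ih (by omega) z (hr.snoc w hA) (present_snoc.2 ⟨h0, hw0 w⟩)
            (present_snoc.2 ⟨h1, hw1⟩)
          exact this
        | some j =>
          exact (max_le (by linarith) (by linarith)).trans (hlose w j (hw0 w) hw1)
      linarith [key 0, key 1]
    | some j =>
      obtain ⟨-, hval, hle⟩ := thresholdBid_spec ha'.symm
      rw [hnt, ← hα, ← hm] at hle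
      have hwin : ∀ w, allocate ![some j, b] w 0 = some j →
          payoff .fullRecall F σ 0 (k + 1) z
            (Fin.snoc (α := fun _ => Record) r ⟨![some j, b], allocate ![some j, b] w⟩) = α := by
        intro w hw
        rw [payoff_of_got σ _ z (hr.snoc w hA) h0 hw, hval]
      have hmax : max ((α + m) / 2) (pairValue F (k + 1) / 2) ≤ (α + m) / 2 :=
        max_le le_rfl (by linarith)
      by_cases hbj : b = some j
      -- In a tie, toss `0` yields `α` and toss `1` at least `m`.
      · subst hbj
        have hl := hlose 1 j (by simp [allocate]) (by simp [allocate])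
        rw [hwin 0 (by simp [allocate])]
        linarith
      -- Uncontested, the bid yields `α` whatever the toss, and `α ≥ (α + m) / 2` because `m ≤ α`.
      · rw [hwin 0 (by simp [allocate]), hwin 1 (by simp [allocate, Ne.symm hbj])]
        linarith

end Guarantee

theorem pairValue_le_two_mul_payoff_thresholdStrategy (F : Measure unitInterval)
    [IsProbabilityMeasure F] (n : ℕ) (σ : Profile .fullRecall)
    (hσ : σ 0 = thresholdStrategy F n) :
    pairValue F n ≤ 2 * payoff .fullRecall F σ 0 n (t := 0) Fin.elim0 Fin.elim0 := by
  cases n with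
  | zero => simp [pairValue, payoff, earned]
  | succ k =>
    have h := max_le_payoff_of_threshold hσ k (t := 0) (Nat.zero_add _) Fin.elim0
      (r := Fin.elim0) (fun s => s.elim0) (fun s => s.elim0) fun s => s.elim0
    linarith [(le_max_right _ _).trans h]

end CompetitiveSelection

end

theorem mainTheorem5 (n : ℕ) (F : MeasureTheory.Measure unitInterval)
    [MeasureTheory.IsProbabilityMeasure F] [MeasureTheory.NullSingletonClass F] (u v : ℝ)
    (hu : (u, u) ∈ CompetitiveSelection.SPEPayoffs .fullRecall F n)
    (hv : (v, v) ∈ CompetitiveSelection.SPEPayoffs .noRecall F n) :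
    v ≤ u := by
  obtain ⟨σ, hσ, hσu⟩ := hu
  obtain ⟨τ, -, hτv⟩ := hv
  rw [Prod.mk.injEq] at hσu hτv
  have hsum :=
    CompetitiveSelection.payoff_add_payoff_noRecall_le_pairValue (F := F) τ n (t := 0) Fin.elim0
    (r := Fin.elim0) (fun s => s.elim0) (fun s => s.elim0) fun s => s.elim0
  have hdev := hσ 0 n (Nat.zero_add n) Fin.elim0 Fin.elim0
    (CompetitiveSelection.IsHistory.nil _) 0
    (CompetitiveSelection.thresholdStrategy F n)
  have hguar := CompetitiveSelection.pairValue_le_two_mul_payoff_thresholdStrategy F n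
    (Function.update σ 0 (CompetitiveSelection.thresholdStrategy F n))
    (Function.update_self _ _ _)
  rw [← hσu.1] at hdev
  -- Symmetry enters here: a bound on the sum of the payoffs becomes a bound on `v`.
  rw [← hτv.1, ← hτv.2] at hsum
  linarith
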